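/- For $d\ge 1$, call a finite family of points in $\mathbb{R}^d$ \emph{convexly independent} if its members are distinct and none of them lies in the convex hull of the others. Let - $E_d(n)$ be the maximum number of (unordered) pairs of distinct points that can be selected from a set of $n$ points in $\mathbb{R}^d$ such that the midpoints of the selected pairs are convexly independent; - $M_d(m,n)$ be the maximum size of a convexly independent subset of the Minkowski sum $P+Q$, over all sets $P$ of $m$ points and $Q$ of $n$ points in $\mathbb{R}^d$; - $W_d(n)$ be the maximum number of pairwise nonparallel segments of unit length with endpoints in a set of $n$ points, over all sets of $n$ points in $\mathbb{R}^d$ and all strictly convex norms on $\mathbb{R}^d$ (two segments on a common line count as parallel). Theorem. In the plane, $E_2(n)$, $M_2(n,n)$ and $W_2(n)$ are all in $\Omega(n\sqrt{\log n})$: there is a constant $c>0$ such that for all integers $n\ge 2$, $$E_2(n)\ge c\,n\sqrt{\log n},\qquad M_2(n,n)\ge c\,n\sqrt{\log n},\qquad W_2(n)\ge c\,n\sqrt{\log n}.$$ -/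

import Mathlib

open scoped Pointwise Affine

namespace MinkowskiSum

/-- The space `ℝ^d`. -/
abbrev Pt (d : ℕ) : Type := EuclideanSpace ℝ (Fin d)

/-- `G` is a set of unordered pairs of distinct points of `P`, i.e. the edge set of a graph
on the vertex set `P`. -/
def IsPairSet {d : ℕ} (P : Finset (Pt d)) (G : Finset (Sym2 (Pt d))) : Prop :=
  ∀ e ∈ G, (∀ x ∈ e, x ∈ P) ∧ ¬ e.IsDiag

/-- The midpoint of an unordered pair. -/
noncomputable def pairMidpoint {d : ℕ} : Sym2 (Pt d) → Pt d :=
  Sym2.lift ⟨fun x y => midpoint ℝ x y, fun x y => midpoint_comm x y⟩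

/-- The sizes of sets of pairs from `n` points of `ℝ^d` with convexly independent midpoints.
`ConvexIndependent` is applied to the family of midpoints, so different pairs
have different midpoints, each of them a vertex of the convex hull of all the midpoints. -/
def midpointSizes (d n : ℕ) : Set ℕ :=
  {k | ∃ (P : Finset (Pt d)) (G : Finset (Sym2 (Pt d))), P.card = n ∧ IsPairSet P G ∧
    ConvexIndependent ℝ (fun e : G => pairMidpoint (e : Sym2 (Pt d))) ∧ G.card = k}

/-- `E_d(n)`: the maximum number of pairs of points from a set of `n` points in `ℝ^d` whose
midpoints are convexly independent. -/
noncomputable def maxMidpointPairs (d n : ℕ) : ℕ := sSup (midpointSizes d n)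

/-- The sizes of convexly independent subsets `S ⊆ P + Q` with `|P| = m`, `|Q| = n`. -/
def sumSizes (d m n : ℕ) : Set ℕ :=
  {k | ∃ P Q S : Finset (Pt d), P.card = m ∧ Q.card = n ∧
    (S : Set (Pt d)) ⊆ (P : Set (Pt d)) + (Q : Set (Pt d)) ∧
    ConvexIndependent ℝ (fun s : S => (s : Pt d)) ∧ S.card = k}

/-- `M_d(m,n)`: the maximum size of a convexly independent subset of `P + Q` over all sets
`P` of `m` points and `Q` of `n` points in `ℝ^d`. -/
noncomputable def maxSumIndependent (d m n : ℕ) : ℕ := sSup (sumSizes d m n)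

/-- A seminorm on `ℝ^d` is a strictly convex norm if it is definite and its closed unit ball
is strictly convex. (All norms on `ℝ^d` induce the usual topology, to which the interior in
`StrictConvex` refers.) -/
def IsStrictlyConvexNorm {d : ℕ} (N : Seminorm ℝ (Pt d)) : Prop :=
  (∀ x, N x = 0 → x = 0) ∧ StrictConvex ℝ (N.closedBall 0 1)

/-- Any two different pairs in `G` span nonparallel lines (a line is parallel to itself). -/
def PairwiseNonparallel {d : ℕ} (G : Finset (Sym2 (Pt d))) : Prop :=
  ∀ x y z w : Pt d, s(x, y) ∈ G → s(z, w) ∈ G → s(x, y) ≠ s(z, w) →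
    ¬ (line[ℝ, x, y] ∥ line[ℝ, z, w])

/-- The sizes of sets of pairwise nonparallel unit-length pairs from `n` points of `ℝ^d`
with respect to some strictly convex norm on `ℝ^d`. -/
def unitSizes (d n : ℕ) : Set ℕ :=
  {k | ∃ (N : Seminorm ℝ (Pt d)) (P : Finset (Pt d)) (G : Finset (Sym2 (Pt d))),
    IsStrictlyConvexNorm N ∧ P.card = n ∧ IsPairSet P G ∧
    (∀ x y : Pt d, s(x, y) ∈ G → N (x - y) = 1) ∧ PairwiseNonparallel G ∧ G.card = k}

/-- `W_d(n)`: the maximum number of pairwise nonparallel segments of unit length among `n`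
points of `ℝ^d`, over all sets of `n` points and all strictly convex norms on `ℝ^d`. -/
noncomputable def maxNonparallelUnit (d n : ℕ) : ℕ := sSup (unitSizes d n)

/-! The three suprema are maxima of nonempty bounded sets, for every `d > 0`. -/

theorem IsPairSet.card_le {d : ℕ} {P : Finset (Pt d)} {G : Finset (Sym2 (Pt d))}
    (h : IsPairSet P G) : G.card ≤ P.sym2.card :=
  Finset.card_le_card fun e he => Finset.mem_sym2_iff.2 (h e he).1

theorem exists_card_eq {d : ℕ} (hd : 0 < d) (n : ℕ) : ∃ P : Finset (Pt d), P.card = n := by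
  have : Nonempty (Fin d) := ⟨⟨0, hd⟩⟩
  have : Infinite (Pt d) := Module.Free.infinite ℝ (Pt d)
  exact Infinite.exists_subset_card_eq _ n |>.imp fun _ h => h

theorem maxMidpointPairs_isGreatest {d : ℕ} (hd : 0 < d) (n : ℕ) :
    IsGreatest (midpointSizes d n) (maxMidpointPairs d n) := by
  have hb : BddAbove (midpointSizes d n) := by
    refine ⟨(n + 1).choose 2, ?_⟩
    rintro k ⟨P, G, hP, hG, -, rfl⟩
    simpa [Finset.card_sym2, hP] using hG.card_le
  obtain ⟨P, hP⟩ := exists_card_eq hd n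
  refine ⟨Nat.sSup_mem ⟨0, P, ∅, hP, by simp [IsPairSet], ?_, rfl⟩ hb, fun k hk => le_csSup hb hk⟩
  intro s x
  exact absurd x.2 (Finset.notMem_empty _)

theorem maxSumIndependent_isGreatest {d : ℕ} (hd : 0 < d) (m n : ℕ) :
    IsGreatest (sumSizes d m n) (maxSumIndependent d m n) := by
  classical
  have hb : BddAbove (sumSizes d m n) := by
    refine ⟨m * n, ?_⟩
    rintro k ⟨P, Q, S, rfl, rfl, hS, -, rfl⟩
    rw [← Finset.coe_add, Finset.coe_subset] at hS
    exact (Finset.card_le_card hS).trans Finset.card_add_le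
  obtain ⟨P, hP⟩ := exists_card_eq hd m
  obtain ⟨Q, hQ⟩ := exists_card_eq hd n
  refine ⟨Nat.sSup_mem ⟨0, P, Q, ∅, hP, hQ, by simp, ?_, rfl⟩ hb, fun k hk => le_csSup hb hk⟩
  intro s x
  exact absurd x.2 (Finset.notMem_empty _)

theorem isStrictlyConvexNorm_euclidean (d : ℕ) :
    IsStrictlyConvexNorm (normSeminorm ℝ (Pt d)) := by
  refine ⟨fun x hx => by simpa using hx, ?_⟩
  rw [closedBall_normSeminorm]
  exact strictConvex_closedBall ℝ _ _

theorem maxNonparallelUnit_isGreatest {d : ℕ} (hd : 0 < d) (n : ℕ) :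
    IsGreatest (unitSizes d n) (maxNonparallelUnit d n) := by
  have hb : BddAbove (unitSizes d n) := by
    refine ⟨(n + 1).choose 2, ?_⟩
    rintro k ⟨N, P, G, -, hP, hG, -, -, rfl⟩
    simpa [Finset.card_sym2, hP] using hG.card_le
  obtain ⟨P, hP⟩ := exists_card_eq hd n
  exact ⟨Nat.sSup_mem ⟨0, _, P, ∅, isStrictlyConvexNorm_euclidean d, hP, by simp [IsPairSet],
    by simp, by simp [PairwiseNonparallel], rfl⟩ hb, fun k hk => le_csSup hb hk⟩

end MinkowskiSum

/-! Point-line incidences are turned into sums on the parabola `y = x²`. The line `y = μ x + β`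
passes through `(X, Y)` exactly when `(X, X² - 4X + 2Y)` and `(μ - 2, (μ - 2)² - 2β)` add up to a
point `(u, u²)`, where `u = X + μ - 2`. Elekes' grid has `k⁴` incidences between fewer than `2k³`
points and `k³` lines; a shear makes all the `u` distinct (`isParabolicSystem_incidences`). Such a
system bounds all three maxima: the sums, and likewise the midpoints, are distinct points of a
parabola, hence convexly independent; after reflecting one summand and translating the other, the
sums become differences on the boundary of a strictly convex ball. The result is a bound of order
`n^(4/3)`, stronger than `n √(log n)`. -/

namespace MinkowskiSum

/-- Points on a parabola with distinct abscissas are convexly independent. -/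
theorem convexIndependent_of_parabola {ι : Type*} {f : ι → Pt 2} {a : ℝ} (ha : 0 < a)
    (hf : ∀ i, f i 1 = a * f i 0 ^ 2) (hinj : Function.Injective fun i => f i 0) :
    ConvexIndependent ℝ f := by
  rw [convexIndependent_iff_notMem_convexHull_sdiff]
  intro i s hi
  -- The tangent at `f i` separates: `l (f j) + a (f i 0)² = a (f j 0 - f i 0)²`.
  let l : Pt 2 →ₗ[ℝ] ℝ :=
    (EuclideanSpace.proj (1 : Fin 2) : Pt 2 →L[ℝ] ℝ).toLinearMap -
      (2 * a * f i 0) • (EuclideanSpace.proj (0 : Fin 2) : Pt 2 →L[ℝ] ℝ).toLinearMap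
  have hl : ∀ v, l v = v 1 - 2 * a * f i 0 * v 0 := fun v => by simp [l]
  have hsub : convexHull ℝ (f '' (s \ {i})) ⊆ {v | -(a * f i 0 ^ 2) < l v} := by
    refine convexHull_min ?_ (convex_halfSpace_gt l.isLinear _)
    rintro _ ⟨j, ⟨-, hj⟩, rfl⟩
    have hne : f j 0 - f i 0 ≠ 0 := sub_ne_zero.2 fun h => hj (hinj h)
    have := mul_pos ha (pow_pos (abs_pos.2 hne) 2)
    rw [sq_abs] at this
    simp only [Set.mem_ofPred_eq, hl, hf j]
    linarith
  have := hsub hi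
  simp only [Set.mem_ofPred_eq, hl, hf i] at this
  linarith

/-! ### Parabolic systems, midpoints and sums -/

/-- A family of pairs of points of the plane whose sums are distinct points `(u, u²)`. -/
structure IsParabolicSystem {ι : Type*} (F : Finset ι) (p q : ι → Pt 2) (u : ι → ℝ) : Prop where
  injOn : Set.InjOn u F
  add_zero : ∀ i ∈ F, p i 0 + q i 0 = u i
  add_one : ∀ i ∈ F, p i 1 + q i 1 = u i ^ 2

theorem exists_superset_card_eq (P : Finset (Pt 2)) {n : ℕ} (h : P.card ≤ n) :
    ∃ P' : Finset (Pt 2), P ⊆ P' ∧ P'.card = n := by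
  have : Infinite (Pt 2) := Module.Free.infinite ℝ (Pt 2)
  exact Infinite.exists_superset_card_eq P n h

section

variable {ι : Type*} {F : Finset ι} {p q : ι → Pt 2} {u : ι → ℝ}

open Classical in
theorem IsParabolicSystem.card_le_maxMidpointPairs (h : IsParabolicSystem F p q u)
    (hne : ∀ i ∈ F, p i ≠ q i) {n : ℕ} (hn : (F.image p).card + (F.image q).card ≤ n) :
    F.card ≤ maxMidpointPairs 2 n := by
  obtain ⟨P, hP, hPn⟩ := exists_superset_card_eq (F.image p ∪ F.image q)
    ((Finset.card_union_le _ _).trans hn)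
  have hmid0 : ∀ i ∈ F, pairMidpoint s(p i, q i) 0 = u i / 2 := fun i hi => by
    simp [pairMidpoint, midpoint_eq_smul_add, ← h.add_zero i hi]; ring
  have hmid1 : ∀ i ∈ F, pairMidpoint s(p i, q i) 1 = u i ^ 2 / 2 := fun i hi => by
    simp [pairMidpoint, midpoint_eq_smul_add, ← h.add_one i hi]; ring
  refine (maxMidpointPairs_isGreatest two_pos n).2
    ⟨P, F.image fun i => s(p i, q i), hPn, ?_, ?_, ?_⟩
  · intro e he
    obtain ⟨i, hi, rfl⟩ := Finset.mem_image.1 he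
    refine ⟨fun x hx => hP ?_, by simpa using hne i hi⟩
    rcases Sym2.mem_iff.1 hx with rfl | rfl
    · exact Finset.mem_union_left _ (Finset.mem_image_of_mem _ hi)
    · exact Finset.mem_union_right _ (Finset.mem_image_of_mem _ hi)
  -- Halving `(u, u²)` lands on the parabola `y = 2x²`.
  · refine convexIndependent_of_parabola two_pos ?_ ?_
    · rintro ⟨e, he⟩
      obtain ⟨i, hi, rfl⟩ := Finset.mem_image.1 he
      simp only [hmid0 i hi, hmid1 i hi]
      ring
    · rintro ⟨e, he⟩ ⟨e', he'⟩ hee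
      obtain ⟨i, hi, rfl⟩ := Finset.mem_image.1 he
      obtain ⟨j, hj, rfl⟩ := Finset.mem_image.1 he'
      simp only [hmid0 i hi, hmid0 j hj] at hee
      have hij : i = j := h.injOn hi hj (by linarith)
      subst hij
      rfl
  · refine Finset.card_image_of_injOn fun i hi j hj hij => h.injOn hi hj ?_
    have := congrArg (fun e => pairMidpoint e 0) hij
    simp only [hmid0 i hi, hmid0 j hj] at this
    linarith

open Classical in
theorem IsParabolicSystem.card_le_maxSumIndependent (h : IsParabolicSystem F p q u)
    {m n : ℕ} (hm : (F.image p).card ≤ m) (hn : (F.image q).card ≤ n) :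
    F.card ≤ maxSumIndependent 2 m n := by
  obtain ⟨P, hP, hPm⟩ := exists_superset_card_eq _ hm
  obtain ⟨Q, hQ, hQn⟩ := exists_superset_card_eq _ hn
  have h0 : ∀ i ∈ F, (p i + q i) 0 = u i := h.add_zero
  have h1 : ∀ i ∈ F, (p i + q i) 1 = u i ^ 2 := h.add_one
  refine (maxSumIndependent_isGreatest two_pos m n).2
    ⟨P, Q, F.image fun i => p i + q i, hPm, hQn, ?_, ?_, ?_⟩
  · intro x hx
    obtain ⟨i, hi, rfl⟩ := Finset.mem_image.1 (Finset.mem_coe.1 hx)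
    exact Set.add_mem_add (hP (Finset.mem_image_of_mem _ hi)) (hQ (Finset.mem_image_of_mem _ hi))
  · refine convexIndependent_of_parabola one_pos ?_ ?_
    · rintro ⟨e, he⟩
      obtain ⟨i, hi, rfl⟩ := Finset.mem_image.1 he
      simp only [h0 i hi, h1 i hi, one_mul]
    · rintro ⟨e, he⟩ ⟨e', he'⟩ hee
      obtain ⟨i, hi, rfl⟩ := Finset.mem_image.1 he
      obtain ⟨j, hj, rfl⟩ := Finset.mem_image.1 he'
      simp only [h0 i hi, h0 j hj] at hee
      have hij : i = j := h.injOn hi hj hee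
      subst hij
      rfl
  · refine Finset.card_image_of_injOn fun i hi j hj hij => h.injOn hi hj ?_
    have := congrArg (fun v : Pt 2 => v 0) hij
    simpa only [h0 i hi, h0 j hj] using this

end

/-! ### A strictly convex norm with parabolic unit arcs -/

/-- The linear map `(x, y) ↦ (2 √T x, y)`. -/
noncomputable def stretch (T : ℝ) : Pt 2 →ₗ[ℝ] Pt 2 where
  toFun v := !₂[2 * √T * v 0, v 1]
  map_add' v w := by ext i; fin_cases i <;> simp [mul_add]
  map_smul' c v := by ext i; fin_cases i <;> simp [mul_left_comm]

theorem stretch_injective {T : ℝ} (hT : 0 < T) : Function.Injective (stretch T) := by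
  intro v w h
  have h0 := congrArg (fun z : Pt 2 => z 0) h
  have h1 := congrArg (fun z : Pt 2 => z 1) h
  have hs : √T ≠ 0 := (Real.sqrt_pos.2 hT).ne'
  simp [stretch, hs] at h0 h1
  ext i
  fin_cases i
  · exact h0
  · exact h1

/-- The norm `(|y| + √(y² + 4 T x²)) / (2 T)`, with unit ball `x² + |y| ≤ T`. -/
noncomputable def lensNorm (T : ℝ) : Seminorm ℝ (Pt 2) :=
  (Real.toNNReal (1 / (2 * T))) •
    ((normSeminorm ℝ ℝ).comp (EuclideanSpace.proj (1 : Fin 2) : Pt 2 →L[ℝ] ℝ).toLinearMap +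
      (normSeminorm ℝ (Pt 2)).comp (stretch T))

theorem lensNorm_apply {T : ℝ} (hT : 0 < T) (v : Pt 2) :
    lensNorm T v = (|v 1| + ‖stretch T v‖) / (2 * T) := by
  have : 0 ≤ 1 / (2 * T) := by positivity
  simp only [lensNorm, smul_apply, add_apply, Seminorm.comp_apply,
    coe_normSeminorm, NNReal.smul_def, Real.coe_toNNReal _ this, smul_eq_mul]
  simp
  ring

theorem norm_stretch {T : ℝ} (hT : 0 < T) (v : Pt 2) :
    ‖stretch T v‖ = √(4 * T * v 0 ^ 2 + v 1 ^ 2) := by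
  rw [EuclideanSpace.norm_eq]
  congr 1
  simp [Fin.sum_univ_two, stretch, mul_pow, Real.sq_sqrt hT.le]
  norm_num

theorem continuous_lensNorm {T : ℝ} (hT : 0 < T) : Continuous (lensNorm T) := by
  have h : (lensNorm T : Pt 2 → ℝ) = fun v => (|v 1| + √(4 * T * v 0 ^ 2 + v 1 ^ 2)) / (2 * T) :=
    funext fun v => by rw [lensNorm_apply hT, norm_stretch hT]
  rw [h]
  fun_prop

/-- The Euclidean summand, pulled back along an injective map, has a strict triangle inequality off
common rays, and adding `|y|` preserves this. On a common ray, two vectors of norm 1 coincide. -/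
theorem isStrictlyConvexNorm_lensNorm {T : ℝ} (hT : 0 < T) :
    IsStrictlyConvexNorm (lensNorm T) := by
  have hdef : ∀ v, lensNorm T v = 0 → v = 0 := by
    intro v hv
    rw [lensNorm_apply hT, div_eq_zero_iff, or_iff_left (by positivity)] at hv
    have : ‖stretch T v‖ = 0 :=
      le_antisymm (by linarith [abs_nonneg (v 1)]) (norm_nonneg _)
    exact stretch_injective hT (by rw [norm_eq_zero.1 this, map_zero])
  refine ⟨hdef, ?_⟩
  intro x hx y hy hxy a b ha hb hab
  rw [Seminorm.mem_closedBall_zero] at hx hy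
  have hlt : lensNorm T (a • x + b • y) < 1 := by
    have htri : lensNorm T (a • x + b • y) ≤ a * lensNorm T x + b * lensNorm T y := by
      refine (map_add_le_add _ _ _).trans_eq ?_
      rw [map_smul_eq_mul, map_smul_eq_mul, Real.norm_of_nonneg ha.le, Real.norm_of_nonneg hb.le]
    by_cases hr : SameRay ℝ x y
    · refine htri.trans_lt ?_
      by_contra hcon
      have hx1 : lensNorm T x = 1 := by nlinarith
      have hy1 : lensNorm T y = 1 := by nlinarith
      obtain ⟨z, r, s, hr₀, hs₀, -, rfl, rfl⟩ := hr.exists_eq_smul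
      rw [map_smul_eq_mul, Real.norm_of_nonneg hr₀] at hx1
      rw [map_smul_eq_mul, Real.norm_of_nonneg hs₀] at hy1
      have hz : lensNorm T z ≠ 0 := by rintro h; simp [h] at hx1
      exact hxy (by rw [mul_right_cancel₀ hz (hx1.trans hy1.symm)])
    · have hstr : ‖stretch T (a • x + b • y)‖ < a * ‖stretch T x‖ + b * ‖stretch T y‖ := by
        rw [map_add, map_smul, map_smul]
        have : ¬ SameRay ℝ (a • stretch T x) (b • stretch T y) := by
          rw [← map_smul, ← map_smul, (stretch_injective hT).sameRay_map_iff]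
          intro h
          have h' := (h.pos_smul_left (inv_pos.2 ha)).pos_smul_right (inv_pos.2 hb)
          rw [inv_smul_smul₀ ha.ne', inv_smul_smul₀ hb.ne'] at h'
          exact hr h'
        have := not_sameRay_iff_norm_add_lt.1 this
        rwa [norm_smul, norm_smul, Real.norm_of_nonneg ha.le, Real.norm_of_nonneg hb.le] at this
      have habs : |(a • x + b • y) 1| ≤ a * |x 1| + b * |y 1| := by
        refine (abs_add_le _ _).trans_eq ?_
        simp [abs_mul, abs_of_pos ha, abs_of_pos hb]
      rw [lensNorm_apply hT, div_le_one (by positivity)] at hx hy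
      rw [lensNorm_apply hT, div_lt_one (by positivity)]
      nlinarith
  refine interior_mono (s := {v | lensNorm T v < 1})
    (fun v hv => (lensNorm T).mem_closedBall_zero.2 (le_of_lt hv)) ?_
  rw [(isOpen_lt (continuous_lensNorm hT) continuous_const).interior_eq]
  exact hlt

/-- The root is `T + u²`, so the numerator is `(T - u²) + (T + u²) = 2T`. -/
theorem lensNorm_eq_one {T : ℝ} (hT : 0 < T) {v : Pt 2} {u : ℝ} (hu : u ^ 2 ≤ T)
    (h0 : v 0 = u) (h1 : v 1 = u ^ 2 - T) : lensNorm T v = 1 := by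
  have : 4 * T * u ^ 2 + (u ^ 2 - T) ^ 2 = (T + u ^ 2) ^ 2 := by ring
  rw [lensNorm_apply hT, norm_stretch hT, h0, h1, this, Real.sqrt_sq (by positivity),
    abs_of_nonpos (by linarith)]
  field_simp
  ring

/-- Parallel lines in the plane have proportional direction vectors. -/
theorem cross_eq_zero_of_parallel {x y z w : Pt 2} (h : line[ℝ, x, y] ∥ line[ℝ, z, w]) :
    (x - y) 0 * (z - w) 1 = (x - y) 1 * (z - w) 0 := by
  have hd := h.direction_eq
  rw [direction_affineSpan, direction_affineSpan] at hd
  have hzw : z -ᵥ w ∈ vectorSpan ℝ {x, y} := by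
    rw [hd]
    exact vsub_mem_vectorSpan ℝ (by simp) (by simp)
  obtain ⟨r, hr⟩ := mem_vectorSpan_pair.1 hzw
  rw [vsub_eq_sub, vsub_eq_sub] at hr
  rw [← hr, PiLp.smul_apply, PiLp.smul_apply, smul_eq_mul, smul_eq_mul]
  ring

/-! ### Nonparallel unit segments -/

section

variable {ι : Type*} {F : Finset ι} {p q : ι → Pt 2} {u : ι → ℝ}

open Classical in
theorem IsParabolicSystem.card_le_maxNonparallelUnit (h : IsParabolicSystem F p q u)
    {n : ℕ} (hn : (F.image p).card + (F.image q).card ≤ n) :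
    F.card ≤ maxNonparallelUnit 2 n := by
  obtain ⟨T, hT, hTu⟩ : ∃ T : ℝ, 0 < T ∧ ∀ i ∈ F, u i ^ 2 < T := by
    refine ⟨∑ i ∈ F, u i ^ 2 + 1, by positivity, fun i hi => ?_⟩
    have := Finset.single_le_sum (f := fun i => u i ^ 2) (fun i _ => sq_nonneg _) hi
    linarith
  -- The differences `p' i - q' i = (u i, u i ^ 2 - T)` lie on the lower arc of the unit ball.
  let p' : ι → Pt 2 := fun i => p i + !₂[0, -T]
  let q' : ι → Pt 2 := fun i => -q i
  have h0 : ∀ i ∈ F, (p' i - q' i) 0 = u i := fun i hi => by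
    simp [p', q', h.add_zero i hi]
  have h1 : ∀ i ∈ F, (p' i - q' i) 1 = u i ^ 2 - T := fun i hi => by
    simp [p', q', ← h.add_one i hi]; ring
  have hN : ∀ i ∈ F, lensNorm T (p' i - q' i) = 1 := fun i hi =>
    lensNorm_eq_one hT (hTu i hi).le (h0 i hi) (h1 i hi)
  have hpar : ∀ i ∈ F, ∀ j ∈ F, line[ℝ, p' i, q' i] ∥ line[ℝ, p' j, q' j] → i = j := by
    intro i hi j hj hij
    have hc := cross_eq_zero_of_parallel hij
    rw [h0 i hi, h0 j hj, h1 i hi, h1 j hj] at hc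
    have hprod : (u j - u i) * (u i * u j + T) = 0 := by linear_combination hc
    -- Strictness of `u² < T` gives `|u i * u j| < T`, which excludes opposite directions.
    have hpos : u i * u j + T ≠ 0 := by
      nlinarith [hTu i hi, hTu j hj, sq_nonneg (u i + u j)]
    refine h.injOn hi hj ?_
    linarith [(mul_eq_zero.1 hprod).resolve_right hpos]
  have hcard : (F.image p' ∪ F.image q').card ≤ n := by
    refine (Finset.card_union_le _ _).trans (le_trans (add_le_add ?_ ?_) hn)
    · rw [show p' = (fun v => v + !₂[0, -T]) ∘ p from rfl, ← Finset.image_image]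
      exact Finset.card_image_le
    · rw [show q' = (fun v => -v) ∘ q from rfl, ← Finset.image_image]
      exact Finset.card_image_le
  obtain ⟨P, hP, hPn⟩ := exists_superset_card_eq _ hcard
  have hline : ∀ {x y z w : Pt 2}, s(x, y) = s(z, w) → line[ℝ, x, y] = line[ℝ, z, w] := by
    intro x y z w hxy
    rcases Sym2.eq_iff.1 hxy with ⟨rfl, rfl⟩ | ⟨rfl, rfl⟩
    · rfl
    · rw [Set.pair_comm]
  refine (maxNonparallelUnit_isGreatest two_pos n).2 ⟨lensNorm T, P,
    F.image fun i => s(p' i, q' i), isStrictlyConvexNorm_lensNorm hT, hPn, ?_, ?_, ?_, ?_⟩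
  · intro e he
    obtain ⟨i, hi, rfl⟩ := Finset.mem_image.1 he
    refine ⟨fun x hx => hP ?_, fun hd => ?_⟩
    · rcases Sym2.mem_iff.1 hx with rfl | rfl
      · exact Finset.mem_union_left _ (Finset.mem_image_of_mem _ hi)
      · exact Finset.mem_union_right _ (Finset.mem_image_of_mem _ hi)
    · have := hN i hi
      rw [Sym2.mk_isDiag_iff.1 hd, sub_self, map_zero] at this
      exact zero_ne_one this
  · intro x y hxy
    obtain ⟨i, hi, hi'⟩ := Finset.mem_image.1 hxy
    rcases Sym2.eq_iff.1 hi' with ⟨rfl, rfl⟩ | ⟨rfl, rfl⟩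
    · exact hN i hi
    · rw [map_sub_rev, hN i hi]
  · intro x y z w hxy hzw hne hpara
    obtain ⟨i, hi, hi'⟩ := Finset.mem_image.1 hxy
    obtain ⟨j, hj, hj'⟩ := Finset.mem_image.1 hzw
    rw [← hline hi', ← hline hj'] at hpara
    exact hne (by rw [← hi', ← hj', hpar i hi j hj hpara])
  · refine Finset.card_image_of_injOn fun i hi j hj hij => hpar i hi j hj ?_
    rw [hline hij]

end

/-! ### The grid and its lines -/

/-- The first points of the construction: the grid point `(i, j)` is sheared to have the
abscissa `2k²i + j`, and then lifted to a parabola. -/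
noncomputable def gridPoint (k : ℕ) (a : ℕ × ℕ) : Pt 2 :=
  !₂[2 * k ^ 2 * a.1 + a.2,
    (2 * k ^ 2 * a.1 + a.2 : ℝ) ^ 2 - 4 * (2 * k ^ 2 * a.1 + a.2) + 2 * a.2]

/-- The second points of the construction: the dual of the sheared line `j = m i + b`. -/
noncomputable def linePoint (k : ℕ) (a : ℕ × ℕ) : Pt 2 :=
  !₂[a.1 / (2 * k ^ 2 + a.1) - 2,
    (a.1 / (2 * k ^ 2 + a.1) - 2 : ℝ) ^ 2 - 2 * (2 * k ^ 2) * a.2 / (2 * k ^ 2 + a.1)]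

/-- The incidences `(i, m, b)` of the points `(i, m i + b)` and the lines `j = m i + b`. -/
def incidences (k : ℕ) : Finset (ℕ × ℕ × ℕ) :=
  Finset.range k ×ˢ Finset.range k ×ˢ Finset.range (k ^ 2)

theorem card_incidences (k : ℕ) : (incidences k).card = k ^ 4 := by
  simp [incidences]; ring

/-- The `-1` lowers the total number of points to at most `3k³ - k`, so that `k = 1` already serves
`n = 2`. -/
theorem mul_add_lt_of_mem_incidences {k : ℕ} {f : ℕ × ℕ × ℕ} (hf : f ∈ incidences k) :
    f.1 < k ∧ f.2.1 < k ∧ f.2.2 < k ^ 2 ∧ f.2.1 * f.1 + f.2.2 < 2 * k ^ 2 - 1 := by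
  simp only [incidences, Finset.mem_product, Finset.mem_range] at hf
  obtain ⟨hi, hm, hb⟩ := hf
  refine ⟨hi, hm, hb, ?_⟩
  have : f.2.1 * f.1 < k ^ 2 := by nlinarith
  omega

/-- With `K = 2k²`, `X = K i + j` and `μ = m / (K + m)`, the line `j = m i + b` becomes `j = μ X + K
b / (K + m)`, which is the cross term needed for `u²`. Since `0 ≤ μ < 1`, the integer part of `u +
2` is `X` and the fractional part is `μ`; these determine `i`, `j` and `m`, hence `b`. -/
theorem isParabolicSystem_incidences (k : ℕ) :
    IsParabolicSystem (incidences k) (fun f => gridPoint k (f.1, f.2.1 * f.1 + f.2.2))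
      (fun f => linePoint k f.2)
      (fun f => 2 * k ^ 2 * f.1 + (f.2.1 * f.1 + f.2.2) + f.2.1 / (2 * k ^ 2 + f.2.1) - 2) := by
  refine ⟨?_, fun f _ => ?_, fun f hf => ?_⟩
  · rintro ⟨i, m, b⟩ hf ⟨i', m', b'⟩ hf' heq
    obtain ⟨hi, hm, hb, hj⟩ := mul_add_lt_of_mem_incidences (Finset.mem_coe.1 hf)
    obtain ⟨hi', hm', hb', hj'⟩ := mul_add_lt_of_mem_incidences (Finset.mem_coe.1 hf')
    simp only at hi hm hb hj hi' hm' hb' hj' heq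
    have hk : (0 : ℝ) < k := by exact_mod_cast (Nat.zero_le _).trans_lt hi
    have hK : (0 : ℝ) < 2 * k ^ 2 := by positivity
    have hμ : ∀ m : ℕ, (0 : ℝ) ≤ m / (2 * k ^ 2 + m) ∧ (m : ℝ) / (2 * k ^ 2 + m) < 1 := fun m =>
      ⟨by positivity, by rw [div_lt_one (by positivity)]; linarith⟩
    have hX : 2 * k ^ 2 * i + (m * i + b) = 2 * k ^ 2 * i' + (m' * i' + b') := by
      have h1 : 2 * k ^ 2 * i + (m * i + b) < 2 * k ^ 2 * i' + (m' * i' + b') + 1 := by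
        have : (2 * k ^ 2 * i + (m * i + b) : ℝ) < 2 * k ^ 2 * i' + (m' * i' + b') + 1 := by
          linarith [(hμ m).1, (hμ m').2]
        exact_mod_cast this
      have h2 : 2 * k ^ 2 * i' + (m' * i' + b') < 2 * k ^ 2 * i + (m * i + b) + 1 := by
        have : (2 * k ^ 2 * i' + (m' * i' + b') : ℝ) < 2 * k ^ 2 * i + (m * i + b) + 1 := by
          linarith [(hμ m').1, (hμ m).2]
        exact_mod_cast this
      omega
    have hii : i = i' := by
      have hdiv : ∀ {i j : ℕ}, j < 2 * k ^ 2 - 1 → (2 * k ^ 2 * i + j) / (2 * k ^ 2) = i := by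
        intro i j h
        rw [Nat.mul_add_div (by omega), Nat.div_eq_of_lt (by omega), add_zero]
      rw [← hdiv (i := i) hj, hX, hdiv hj']
    subst hii
    have hXr : (2 * k ^ 2 * i + (m * i + b) : ℝ) = 2 * k ^ 2 * i + (m' * i + b') := by
      exact_mod_cast hX
    have hmm : (m : ℝ) / (2 * k ^ 2 + m) = m' / (2 * k ^ 2 + m') := by linarith
    rw [div_eq_div_iff (by positivity) (by positivity)] at hmm
    have hmm' : (m : ℝ) = m' := by
      refine mul_right_cancel₀ hK.ne' ?_
      linarith
    have hmm'' : m = m' := by exact_mod_cast hmm'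
    subst hmm''
    have : b = b' := by omega
    rw [this]
  · simp [gridPoint, linePoint]
    ring
  · have hk : (0 : ℝ) < k := by
      exact_mod_cast (Nat.zero_le _).trans_lt (mul_add_lt_of_mem_incidences hf).1
    have : (2 * k ^ 2 + f.2.1 : ℝ) ≠ 0 := by positivity
    simp [gridPoint, linePoint]
    field_simp
    ring

open Classical in
theorem card_image_gridPoint (k : ℕ) :
    ((incidences k).image fun f => gridPoint k (f.1, f.2.1 * f.1 + f.2.2)).card ≤
      k * (2 * k ^ 2 - 1) := by
  have hsub : ((incidences k).image fun f => gridPoint k (f.1, f.2.1 * f.1 + f.2.2)) ⊆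
      (Finset.range k ×ˢ Finset.range (2 * k ^ 2 - 1)).image (gridPoint k) := by
    intro x hx
    obtain ⟨f, hf, rfl⟩ := Finset.mem_image.1 hx
    obtain ⟨hi, -, -, hj⟩ := mul_add_lt_of_mem_incidences hf
    exact Finset.mem_image_of_mem _ (by simp [hi, hj])
  exact (Finset.card_le_card hsub).trans (Finset.card_image_le.trans_eq (by simp))

open Classical in
theorem card_image_linePoint (k : ℕ) :
    ((incidences k).image fun f => linePoint k f.2).card ≤ k ^ 3 := by
  have hsub : ((incidences k).image fun f => linePoint k f.2) ⊆
      (Finset.range k ×ˢ Finset.range (k ^ 2)).image (linePoint k) := by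
    intro x hx
    obtain ⟨f, hf, rfl⟩ := Finset.mem_image.1 hx
    exact Finset.mem_image_of_mem _ (Finset.mem_product.1 hf).2
  exact (Finset.card_le_card hsub).trans (Finset.card_image_le.trans_eq (by simp; ring))

theorem gridPoint_ne_linePoint (k : ℕ) (a b : ℕ × ℕ) : gridPoint k a ≠ linePoint k b := by
  intro h
  have h0 := congrArg (fun v : Pt 2 => v 0) h
  simp only [gridPoint, linePoint, PiLp.toLp_apply, Matrix.cons_val_zero] at h0
  -- The shift by `-2` puts the second points at abscissas at most `-1`, while the first have
  -- nonnegative ones.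
  have h1 : (b.1 : ℝ) / (2 * k ^ 2 + b.1) ≤ 1 := div_le_one_of_le₀ (by nlinarith) (by positivity)
  have h2 : (0 : ℝ) ≤ 2 * k ^ 2 * a.1 + a.2 := by positivity
  linarith

/-- All three maxima are at least `k⁴` if `n ≥ 3 k³ - 1`. -/
theorem pow_four_le {k n : ℕ} (hk : 0 < k) (hn : 3 * k ^ 3 ≤ n + 1) :
    k ^ 4 ≤ maxMidpointPairs 2 n ∧ k ^ 4 ≤ maxSumIndependent 2 n n ∧
      k ^ 4 ≤ maxNonparallelUnit 2 n := by
  classical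
  have h := isParabolicSystem_incidences k
  have hp := card_image_gridPoint k
  have hq := card_image_linePoint k
  have hsum : k * (2 * k ^ 2 - 1) + k ^ 3 ≤ n := by
    have : k * (2 * k ^ 2 - 1) + k = 2 * k ^ 3 := by
      obtain ⟨c, hc⟩ : ∃ c, 2 * k ^ 2 = c + 1 := ⟨2 * k ^ 2 - 1, by have := pow_pos hk 2; omega⟩
      rw [hc, Nat.add_sub_cancel]
      linear_combination k * hc.symm
    omega
  rw [← card_incidences k]
  refine ⟨h.card_le_maxMidpointPairs (fun f _ => gridPoint_ne_linePoint k _ _) ?_,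
    h.card_le_maxSumIndependent ?_ ?_, h.card_le_maxNonparallelUnit ?_⟩
  all_goals omega

/-! ### Choice of `k` and the final estimate -/

theorem exists_scale {n : ℕ} (hn : 2 ≤ n) :
    ∃ k : ℕ, 0 < k ∧ 3 * k ^ 3 ≤ n + 1 ∧ n ≤ 24 * k ^ 3 := by
  let k := Nat.findGreatest (fun k => 3 * k ^ 3 ≤ n + 1) (n + 1)
  have h1 : 1 ≤ k := Nat.le_findGreatest (by omega) (by omega)
  have h2 : 3 * k ^ 3 ≤ n + 1 :=
    Nat.findGreatest_spec (P := fun k => 3 * k ^ 3 ≤ n + 1) (m := 1) (by omega) (by omega)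
  refine ⟨k, h1, h2, ?_⟩
  have hle : k + 1 ≤ n + 1 := by
    have : k ≤ k ^ 3 := Nat.le_self_pow (by norm_num) k
    omega
  have h3 : ¬ 3 * (k + 1) ^ 3 ≤ n + 1 :=
    Nat.findGreatest_is_greatest (P := fun k => 3 * k ^ 3 ≤ n + 1) (Nat.lt_succ_self k) hle
  -- By maximality of `k`, `n + 1 < 3 (k + 1)³ ≤ 3 (2k)³ = 24 k³`.
  have h4 : (k + 1) ^ 3 ≤ (2 * k) ^ 3 := Nat.pow_le_pow_left (by omega) 3
  rw [mul_pow] at h4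
  omega

theorem mul_sqrt_log_le {n k : ℕ} (hk : 0 < k) (hn : 2 ≤ n) (hnk : n ≤ 24 * k ^ 3) :
    1 / 144 * (n * √(Real.log n)) ≤ ((k ^ 4 : ℕ) : ℝ) := by
  have hk1 : (1 : ℝ) ≤ k := by exact_mod_cast hk
  have hn0 : (0 : ℝ) < n := by exact_mod_cast two_pos.trans_le hn
  have hnk' : (n : ℝ) ≤ 24 * k ^ 3 := by exact_mod_cast hnk
  -- A crude bound suffices: `√(log n) ≤ 6k` and `n ≤ 24k³` give the constant `144 = 24 · 6`.
  have hlog : Real.log n ≤ (6 * k) ^ 2 := by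
    have h1 : Real.log n ≤ Real.log 24 + 3 * Real.log k := by
      refine (Real.log_le_log hn0 hnk').trans_eq ?_
      rw [Real.log_mul (by norm_num) (by positivity), Real.log_pow]
      norm_num
    have h2 : Real.log 24 ≤ 24 - 1 := Real.log_le_sub_one_of_pos (by norm_num)
    have h3 : Real.log k ≤ k - 1 := Real.log_le_sub_one_of_pos (by linarith)
    nlinarith
  have hsq : √(Real.log n) ≤ 6 * k := by
    rw [← Real.sqrt_sq (by positivity : (0 : ℝ) ≤ 6 * k)]
    exact Real.sqrt_le_sqrt hlog
  have := mul_le_mul hnk' hsq (Real.sqrt_nonneg _) (by positivity)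
  push_cast
  linarith

end MinkowskiSum

theorem mainTheorem2 :
    ∃ c : ℝ, 0 < c ∧ ∀ n : ℕ, 2 ≤ n →
      c * (n * √(Real.log n)) ≤ (MinkowskiSum.maxMidpointPairs 2 n : ℝ) ∧
      c * (n * √(Real.log n)) ≤ (MinkowskiSum.maxSumIndependent 2 n n : ℝ) ∧
      c * (n * √(Real.log n)) ≤ (MinkowskiSum.maxNonparallelUnit 2 n : ℝ) := by
  refine ⟨1 / 144, by norm_num, fun n hn => ?_⟩
  obtain ⟨k, hk, hkn, hnk⟩ := MinkowskiSum.exists_scale hn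
  obtain ⟨hE, hM, hW⟩ := MinkowskiSum.pow_four_le hk hkn
  have h := MinkowskiSum.mul_sqrt_log_le hk hn hnk
  exact ⟨h.trans (Nat.cast_le.2 hE), h.trans (Nat.cast_le.2 hM), h.trans (Nat.cast_le.2 hW)⟩
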